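/- Let $K,d,S,N$ be positive integers with $S+2\le N\le d(K-1)+S$, write $[n]=\{0,\dots,n-1\}$, and let $w\in\mathbb{C}^K$ have all entries $w_k\neq 0$. A non-straggler pattern is a nonempty collection $\boldsymbol{\mathcal N}$ of subsets of $[N]$, each of cardinality $N-S$. For such a pattern put $\mathcal I=\bigcap_{\mathcal A\in\boldsymbol{\mathcal N}}\mathcal A$, $I=|\mathcal I|$, $L=N-S-I$, $C=d(K-1)+S+1-N$, and $$I^*=\begin{cases}\left\lfloor\frac{K-1}{2}\right\rfloor+1,& d=1,\\ (d-1)(K-1)+1,& d\ge 2.\end{cases}$$ There is a proper algebraic subset $Z\subsetneq\mathbb{C}^K$, depending only on $K,N,d,S,w$, such that for all pairwise distinct data points $\alpha_0,\dots,\alpha_{K-1}\in\mathbb{C}$ with $(\alpha_0,\dots,\alpha_{K-1})\notin Z$ and every non-straggler pattern $\boldsymbol{\mathcal N}$ the following hold. 1. There exist pairwise distinct $\beta_n\in\mathbb{C}$ ($n\in\mathcal I$), different from all $\alpha_k$, such that, with $P_{\mathcal I}(z)=\prod_{n\in\mathcal I}(z-\beta_n)$, $$\sum_{k=0}^{K-1}w_k\,P_{\mathcal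 I}(\alpha_k)\,\alpha_k^j=0\quad\text{for all } 0\le j<C+L,$$ if and only if $I\ge I^*$. 2. If $I\ge I^*$, then there exist pairwise distinct $\beta_n\in\mathbb{C}$ ($n\in[N]$), different from all $\alpha_k$, such that for every $\mathcal A\in\boldsymbol{\mathcal N}$ $$\sum_{k=0}^{K-1}w_k\,\Big(\prod_{n\in\mathcal A}(\alpha_k-\beta_n)\Big)\alpha_k^j=0\quad\text{for all } 0\le j<C,$$ and such that the coded polynomial aggregation (CPA) scheme with these points is feasible over $\boldsymbol{\mathcal N}$, that is: for every polynomial $F\in\mathbb{C}[z]$ of degree $d$, all matrices $X_0,\dots,X_{K-1}\in\mathbb{C}^{q\times v}$ (any $q,v$) and every $\mathcal A\in\boldsymbol{\mathcal N}$, one has $$\sum_{k=0}^{K-1}w_k\,D(\alpha_k)=\sum_{k=0}^{K-1}w_k\,F(X_k),$$ where $F$ acts entrywise, $E(z)$ is the matrix polynomial of degree at most $K-1$ with $E(\alpha_k)=X_k$ for all $k$, and $D(z)$ is the matrix polynomial of degree at most $N-S-1$ with $D(\beta_n)=F(E(\beta_n))$ for all $n\in\mathcal A$. -/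

import Mathlib

open Polynomial

noncomputable section

/-- A non-straggler pattern: a nonempty collection of subsets of the worker set `[N]`,
each of cardinality `N - S`. -/
structure NonStragglerPattern (N S : ℕ) where
  sets : Finset (Finset (Fin N))
  nonempty : sets.Nonempty
  card_eq : ∀ A ∈ sets, A.card = N - S

namespace NonStragglerPattern

variable {N S : ℕ}

/-- The intersection `𝓘` of all the non-straggler sets. -/
def inter (P : NonStragglerPattern N S) : Finset (Fin N) :=
  Finset.univ.filter fun n => ∀ A ∈ P.sets, n ∈ A

/-- `I = |𝓘|`. -/
def interCard (P : NonStragglerPattern N S) : ℕ := P.inter.card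

/-- `L = N - S - I` (no truncation occurs, since `𝓘` is contained in a set of
cardinality `N - S`). -/
def excess (P : NonStragglerPattern N S) : ℕ := N - S - P.interCard

end NonStragglerPattern

namespace CPA

/-- `C = d (K - 1) + S + 1 - N` (no truncation occurs when `1 ≤ K` and
`N ≤ d (K - 1) + S`). -/
def numConditions (K d S N : ℕ) : ℕ := d * (K - 1) + S + 1 - N

/-- The threshold `I*`. -/
def threshold (K d : ℕ) : ℕ :=
  if d = 1 then (K - 1) / 2 + 1 else (d - 1) * (K - 1) + 1

/-- Admissible evaluation points: pairwise distinct and different from all data points. -/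
def Admissible {K : ℕ} {ι : Type*} (α : Fin K → ℂ) (β : ι → ℂ) : Prop :=
  Function.Injective β ∧ Disjoint (Set.range α) (Set.range β)

/-- The conditions `∑ₖ wₖ P(αₖ) αₖ ^ j = 0` for `j = 0, …, m - 1`. -/
def Orthogonal {K : ℕ} (w α : Fin K → ℂ) (P : ℂ[X]) (m : ℕ) : Prop :=
  ∀ j < m, ∑ k, w k * P.eval (α k) * α k ^ j = 0

/-- The encoder polynomial `E(z)`, a matrix of polynomials of degree `< K` with
`E(αₖ) = Xₖ` for all `k`. -/
def encoder {K q v : ℕ} (α : Fin K → ℂ) (X : Fin K → Matrix (Fin q) (Fin v) ℂ) :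
    Matrix (Fin q) (Fin v) ℂ[X] :=
  Matrix.of fun a b => Lagrange.interpolate Finset.univ α fun k => X k a b

/-- The response `F(E(βₙ))` of worker `n`, with `F` applied to each matrix entry. -/
def response {K N q v : ℕ} (α : Fin K → ℂ) (β : Fin N → ℂ) (F : ℂ[X])
    (X : Fin K → Matrix (Fin q) (Fin v) ℂ) (n : Fin N) : Matrix (Fin q) (Fin v) ℂ :=
  ((encoder α X).map fun e => e.eval (β n)).map fun x => F.eval x

/-- The decoder polynomial `D(z)`, a matrix of polynomials of degree `< |A|` with
`D(βₙ) = F(E(βₙ))` for all `n ∈ A`. -/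
def decoder {K N q v : ℕ} (α : Fin K → ℂ) (β : Fin N → ℂ) (F : ℂ[X])
    (X : Fin K → Matrix (Fin q) (Fin v) ℂ) (A : Finset (Fin N)) :
    Matrix (Fin q) (Fin v) ℂ[X] :=
  Matrix.of fun a b => Lagrange.interpolate A β fun n => response α β F X n a b

/-- The decoded output `∑ₖ wₖ D(αₖ)` from the responses of the workers in `A`. -/
def decodedOutput {K N q v : ℕ} (w α : Fin K → ℂ) (β : Fin N → ℂ) (F : ℂ[X])
    (X : Fin K → Matrix (Fin q) (Fin v) ℂ) (A : Finset (Fin N)) :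
    Matrix (Fin q) (Fin v) ℂ :=
  ∑ k, w k • (decoder α β F X A).map fun e => e.eval (α k)

/-- The desired aggregation `Y = ∑ₖ wₖ F(Xₖ)`. -/
def aggregation {K q v : ℕ} (w : Fin K → ℂ) (F : ℂ[X])
    (X : Fin K → Matrix (Fin q) (Fin v) ℂ) : Matrix (Fin q) (Fin v) ℂ :=
  ∑ k, w k • (X k).map fun x => F.eval x

/-- The CPA scheme with data points `α` and evaluation points `β` is feasible over the
pattern `P`: for every polynomial function `F` of degree `d` and all data matrices, the
decoded output is the desired aggregation for every non-straggler set of the pattern. -/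
def Feasible {K N S : ℕ} (d : ℕ) (w α : Fin K → ℂ) (β : Fin N → ℂ)
    (P : NonStragglerPattern N S) : Prop :=
  ∀ (q v : ℕ) (F : ℂ[X]) (X : Fin K → Matrix (Fin q) (Fin v) ℂ), F.natDegree = d →
    ∀ A ∈ P.sets, decodedOutput w α β F X A = aggregation w F X

end CPA

end

open Polynomial

/-! Part 1 asks for a monic separable `p` of degree `m = I`, nonzero at all `αₖ`, orthogonal to the
powers `z ^ j` with `j < d (K - 1) + 1 - m`; its roots are then the `βₙ`. Necessity: `K` or more
conditions force `p (αₖ) = 0` by Vandermonde. This settles `d ≥ 2`. For `d = 1` below the threshold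
there are at least `m + 1` conditions, so the coefficients of `p` lie in the kernel of the Hankel
matrix of size `m + 1`, which is generically invertible. Sufficiency: for `d = 1` the `m`-th
orthogonal polynomial satisfies `m ≥ K - m` conditions. For `d ≥ 2` one has `m ≥ K` and at most `K -
1` conditions, so the values `p (αₖ)` can be prescribed proportional to `nodalWeight / wₖ`, and the
remaining freedom makes `p` separable (`exists_separable_orthogonal_of_le`). The exceptional set is
the zero locus of a product of Hankel determinants, resultants and values of orthogonal polynomials,
viewed as polynomials in `α`. Each is nonzero because it is nonzero at a configuration where the
data points merge into few points of nonzero total weight (`exists_genericity_polynomial`). Part 2: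
the remaining `βₙ` are arbitrary. The `L` extra factors use up `L` conditions, and the `C` left
annihilate the decoding error, a multiple of `P_A`. -/

namespace CPA

/-! ### Hankel matrices and orthogonal polynomials over a commutative ring -/

section Hankel

variable {R S : Type*} [CommRing R] [CommRing S] {K : ℕ}

/-- The Hankel matrix of the moments of the weighted point configuration `(w, α)`. -/
def hankel (w α : Fin K → R) (m : ℕ) : Matrix (Fin m) (Fin m) R :=
  Matrix.of fun i j => ∑ k, w k * α k ^ ((i : ℕ) + j)

/-- The polynomial of degree at most `m` given by the last column of the adjugate of the
Hankel matrix of size `m + 1`: the unnormalised `m`-th orthogonal polynomial. -/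
noncomputable def orthPoly (w α : Fin K → R) (m : ℕ) : R[X] :=
  ∑ i : Fin (m + 1), C ((hankel w α (m + 1)).adjugate i (Fin.last m)) * X ^ (i : ℕ)

theorem map_hankel (f : R →+* S) (w α : Fin K → R) (m : ℕ) :
    f.mapMatrix (hankel w α m) = hankel (fun k => f (w k)) (fun k => f (α k)) m := by
  ext i j
  simp [hankel]

theorem map_det_hankel (f : R →+* S) (w α : Fin K → R) (m : ℕ) :
    f (hankel w α m).det = (hankel (fun k => f (w k)) (fun k => f (α k)) m).det := by
  rw [RingHom.map_det, map_hankel]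

theorem map_orthPoly (f : R →+* S) (w α : Fin K → R) (m : ℕ) :
    (orthPoly w α m).map f = orthPoly (fun k => f (w k)) (fun k => f (α k)) m := by
  simp only [orthPoly, Polynomial.map_sum, Polynomial.map_mul, Polynomial.map_C,
    Polynomial.map_pow, Polynomial.map_X]
  refine Finset.sum_congr rfl fun i _ => ?_
  rw [← map_hankel, ← RingHom.map_adjugate]
  rfl

theorem hankel_mulVec (w α : Fin K → R) (m : ℕ) (c : Fin m → R) (j : Fin m) :
    (hankel w α m).mulVec c j =
      ∑ k, w k * (∑ i : Fin m, C (c i) * X ^ (i : ℕ)).eval (α k) * α k ^ (j : ℕ) := by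
  simp only [Matrix.mulVec, dotProduct, hankel, Matrix.of_apply, eval_finsetSum, eval_mul,
    eval_C, eval_pow, eval_X, Finset.sum_mul, Finset.mul_sum]
  rw [Finset.sum_comm]
  refine Finset.sum_congr rfl fun k _ => Finset.sum_congr rfl fun i _ => ?_
  ring

/-- This is the last column of `H * adjugate H = det H • 1`. -/
theorem sum_orthPoly_mul_pow (w α : Fin K → R) (m : ℕ) (j : Fin (m + 1)) :
    ∑ k, w k * (orthPoly w α m).eval (α k) * α k ^ (j : ℕ) =
      if j = Fin.last m then (hankel w α (m + 1)).det else 0 := by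
  rw [orthPoly, ← hankel_mulVec]
  have h := congrFun (congrFun (Matrix.mul_adjugate (hankel w α (m + 1))) j) (Fin.last m)
  rw [Matrix.mul_apply] at h
  simp only [Matrix.mulVec, dotProduct, h, Matrix.smul_apply, Matrix.one_apply, smul_eq_mul,
    mul_ite, mul_one, mul_zero]

theorem coeff_sum_C_mul_X_pow {m : ℕ} (c : Fin m → R) (i : Fin m) :
    (∑ i : Fin m, C (c i) * X ^ (i : ℕ)).coeff i = c i := by
  simp [finsetSum_coeff, coeff_X_pow, Fin.val_inj]

theorem coeff_orthPoly (w α : Fin K → R) (m : ℕ) :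
    (orthPoly w α m).coeff m = (hankel w α m).det := by
  have h := coeff_sum_C_mul_X_pow
    (fun i => (hankel w α (m + 1)).adjugate i (Fin.last m)) (Fin.last m)
  rw [Fin.val_last] at h
  rw [orthPoly, h, Matrix.adjugate_fin_succ_eq_det_submatrix]
  simp only [Fin.val_last, Fin.succAbove_last, ← two_mul, pow_mul, neg_one_sq, one_pow, one_mul]
  rfl

theorem natDegree_orthPoly_le (w α : Fin K → R) (m : ℕ) : (orthPoly w α m).natDegree ≤ m :=
  natDegree_le_iff_degree_le.mpr (Order.lt_succ_iff.mp (degree_sum_fin_lt _))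

end Hankel

/-! ### Orthogonality over the complex numbers -/

section Field

variable {K : ℕ}

theorem orthogonal_orthPoly (w α : Fin K → ℂ) (m : ℕ) : Orthogonal w α (orthPoly w α m) m := by
  intro j hj
  rw [sum_orthPoly_mul_pow w α m ⟨j, hj.trans (Nat.lt_succ_self m)⟩, if_neg]
  simpa [Fin.ext_iff] using hj.ne

theorem natDegree_orthPoly {w α : Fin K → ℂ} {m : ℕ} (h : (hankel w α m).det ≠ 0) :
    (orthPoly w α m).natDegree = m :=
  natDegree_eq_of_le_of_coeff_ne_zero (natDegree_orthPoly_le w α m) (by rwa [coeff_orthPoly])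

theorem orthPoly_ne_zero {w α : Fin K → ℂ} {m : ℕ} (h : (hankel w α (m + 1)).det ≠ 0) :
    orthPoly w α m ≠ 0 := by
  intro h0
  have := sum_orthPoly_mul_pow w α m (Fin.last m)
  rw [h0, if_pos rfl] at this
  exact h (by simpa using this.symm)

theorem Orthogonal.mono {w α : Fin K → ℂ} {p : ℂ[X]} {m n : ℕ} (h : Orthogonal w α p n)
    (hmn : m ≤ n) : Orthogonal w α p m := fun j hj => h j (hj.trans_le hmn)

theorem Orthogonal.sum_eval_mul {w α : Fin K → ℂ} {p : ℂ[X]} {n : ℕ} (h : Orthogonal w α p n)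
    {q : ℂ[X]} (hq : q.degree < n) : ∑ k, w k * (p * q).eval (α k) = 0 := by
  rcases eq_or_ne q 0 with rfl | hq0
  · simp
  have hq' := (natDegree_lt_iff_degree_lt hq0).mpr hq
  calc ∑ k, w k * (p * q).eval (α k)
      = ∑ k, ∑ j ∈ Finset.range n, q.coeff j * (w k * p.eval (α k) * α k ^ j) := by
        refine Finset.sum_congr rfl fun k _ => ?_
        rw [eval_mul, eval_eq_sum_range' hq', Finset.mul_sum, Finset.mul_sum]
        exact Finset.sum_congr rfl fun j _ => by ring
    _ = ∑ j ∈ Finset.range n, q.coeff j * ∑ k, w k * p.eval (α k) * α k ^ j := by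
        rw [Finset.sum_comm]
        exact Finset.sum_congr rfl fun j _ => (Finset.mul_sum _ _ _).symm
    _ = 0 := Finset.sum_eq_zero fun j hj => by rw [h j (Finset.mem_range.mp hj), mul_zero]

/-- An extra factor of degree `r` costs at most `r` conditions, since `q * X ^ j` is again an
admissible test polynomial. -/
theorem Orthogonal.mul_right {w α : Fin K → ℂ} {p : ℂ[X]} {m n : ℕ} (h : Orthogonal w α p n)
    {q : ℂ[X]} (hq : q.natDegree + m ≤ n) : Orthogonal w α (p * q) m := by
  intro j hj
  rw [← h.sum_eval_mul (q := q * X ^ j)]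
  · refine Finset.sum_congr rfl fun k _ => ?_
    simp only [eval_mul, eval_pow, eval_X]
    ring
  · refine (degree_mul_le _ _).trans_lt ?_
    rw [degree_X_pow]
    refine lt_of_le_of_lt (add_le_add_left degree_le_natDegree _) ?_
    exact_mod_cast (by omega : q.natDegree + j < n)

/-- By the Vandermonde determinant, too many conditions force `P` to vanish on the data. -/
theorem Orthogonal.eval_eq_zero {w α : Fin K → ℂ} (hw : ∀ k, w k ≠ 0)
    (hα : Function.Injective α) {p : ℂ[X]} {n : ℕ} (h : Orthogonal w α p n) (hn : K ≤ n)
    (k : Fin K) : p.eval (α k) = 0 := by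
  have := congrFun (Matrix.eq_zero_of_forall_pow_sum_mul_pow_eq_zero
    (v := fun k => w k * p.eval (α k)) hα fun i => h i (i.2.trans_le hn)) k
  simpa [hw k] using this

/-- Kernel vectors of the Hankel matrix are exactly the coefficient vectors of such `q`, by
`hankel_mulVec`. -/
theorem det_hankel_eq_zero_iff (w α : Fin K → ℂ) (m : ℕ) :
    (hankel w α m).det = 0 ↔ ∃ q : ℂ[X], q ≠ 0 ∧ q.degree < m ∧ Orthogonal w α q m := by
  rw [← Matrix.exists_mulVec_eq_zero_iff]
  constructor
  · rintro ⟨c, hc, h⟩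
    refine ⟨∑ i : Fin m, C (c i) * X ^ (i : ℕ), fun h0 => hc (funext fun i => ?_),
      degree_sum_fin_lt c, fun j hj => ?_⟩
    · rw [← coeff_sum_C_mul_X_pow c i, h0]
      simp
    · rw [← hankel_mulVec w α m c ⟨j, hj⟩, h]
      rfl
  · rintro ⟨q, hq0, hq, h⟩
    have hsum : ∑ i : Fin m, C (q.coeff i) * X ^ (i : ℕ) = q := by
      rw [Fin.sum_univ_eq_sum_range (fun i => C (q.coeff i) * X ^ i),
        ← as_sum_range_C_mul_X_pow' _ ((natDegree_lt_iff_degree_lt hq0).mpr hq)]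
    refine ⟨fun i => q.coeff i, fun h0 => hq0 ?_, funext fun j => ?_⟩
    · rw [← hsum]
      exact Finset.sum_eq_zero fun i _ => by rw [show q.coeff i = 0 from congrFun h0 i]; simp
    · rw [hankel_mulVec, hsum]
      exact h j j.2

theorem det_hankel_ne_zero {w α : Fin K → ℂ} (hw : ∀ k, w k ≠ 0) (hα : Function.Injective α) :
    (hankel w α K).det ≠ 0 := by
  rw [Ne, det_hankel_eq_zero_iff]
  rintro ⟨q, hq0, hq, h⟩
  refine hq0 (Polynomial.eq_zero_of_degree_lt_of_eval_index_eq_zero (s := Finset.univ) (v := α) hα.injOn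
    (by simpa using hq) fun k _ => h.eval_eq_zero hw hα le_rfl k)

/-- With one point more than its degree, the orthogonal polynomial vanishes at no point. -/
theorem orthPoly_eval_ne_zero {m : ℕ} {w α : Fin (m + 1) → ℂ} (hw : ∀ k, w k ≠ 0)
    (hα : Function.Injective α) (k : Fin (m + 1)) : (orthPoly w α m).eval (α k) ≠ 0 := by
  intro hk
  have hp := orthPoly_ne_zero (det_hankel_ne_zero hw hα)
  have horth := orthogonal_orthPoly w α m
  generalize hq : orthPoly w α m = p at *
  -- With the `k`-th term gone, `m` conditions remain on `m` distinct points, so the other values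
  -- vanish too; a polynomial of degree at most `m` would then have `m + 1` roots.
  have h := Matrix.eq_zero_of_forall_pow_sum_mul_pow_eq_zero
    (v := fun i => w (k.succAbove i) * p.eval (α (k.succAbove i)))
    (hα.comp Fin.succAbove_right_injective) fun j => by
      have := horth j j.2
      rwa [Fin.sum_univ_succAbove _ k, hk, mul_zero, zero_mul, zero_add] at this
  refine hp (Polynomial.eq_zero_of_degree_lt_of_eval_index_eq_zero (s := Finset.univ) (v := α) hα.injOn ?_ ?_)
  · rw [← hq, Finset.card_univ, Fintype.card_fin]
    exact degree_sum_fin_lt _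
  · intro i _
    rcases Fin.eq_self_or_eq_succAbove k i with rfl | ⟨i, rfl⟩
    · exact hk
    · simpa [hw] using congrFun h i

end Field

/-! ### Merging data points -/

section Collapse

variable {R : Type*} [CommRing R] {K n : ℕ}

/-- The weights obtained by adding up `w` along the fibres of `c`. -/
def pushWeight (c : Fin K → Fin n) (w : Fin K → R) (i : Fin n) : R :=
  ∑ k with c k = i, w k

/-- Moments see only the total weight sitting at each point. -/
theorem hankel_comp (c : Fin K → Fin n) (w : Fin K → R) (x : Fin n → R) (m : ℕ) :
    hankel w (x ∘ c) m = hankel (pushWeight c w) x m := by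
  ext i j
  simp only [hankel, Matrix.of_apply, pushWeight, Finset.sum_mul]
  rw [← Finset.sum_fiberwise Finset.univ c]
  refine Finset.sum_congr rfl fun a _ => Finset.sum_congr rfl fun k hk => ?_
  rw [← (Finset.mem_filter.mp hk).2]
  rfl

theorem orthPoly_comp (c : Fin K → Fin n) (w : Fin K → R) (x : Fin n → R) (m : ℕ) :
    orthPoly w (x ∘ c) m = orthPoly (pushWeight c w) x m := by
  rw [orthPoly, hankel_comp, ← orthPoly]

end Collapse

/-- If all these sums vanished, comparing the identity with the swap of index `0` and a tail index
would make all tail weights equal to `w 0`, and the tail sum a nonzero multiple of it. The bound `1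
≤ n` keeps `0` out of the tail; the sum of all weights may well be zero. -/
theorem exists_perm_tail_sum_ne_zero {K n : ℕ} (hn : 1 ≤ n) (hnK : n < K) (w : Fin K → ℂ)
    (hw : ∀ k, w k ≠ 0) :
    ∃ σ : Equiv.Perm (Fin K), ∑ k with n ≤ Fin.val k, w (σ k) ≠ 0 := by
  by_contra! h
  let z : Fin K := ⟨0, by omega⟩
  have hz (j : Fin K) (hj : n ≤ j.val) : w j = w z := by
    have hmem : j ∈ Finset.univ.filter fun k : Fin K => n ≤ k.val := by simpa using hj
    have h1 := h 1
    have h2 := h (Equiv.swap z j)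
    rw [← Finset.add_sum_erase _ _ hmem] at h1 h2
    rw [Equiv.swap_apply_right] at h2
    rw [Finset.sum_congr rfl (g := fun k => w ((1 : Equiv.Perm (Fin K)) k))] at h2
    · exact add_right_cancel (h1.trans h2.symm)
    · intro k hk
      simp only [Finset.mem_erase, Finset.mem_filter, Finset.mem_univ, true_and] at hk
      rw [Equiv.swap_apply_of_ne_of_ne _ hk.1]
      · rfl
      · rintro rfl
        exact absurd hk.2 (by simp [z]; omega)
  have h1 := h 1
  simp only [Equiv.Perm.coe_one, id_eq] at h1
  rw [Finset.sum_congr rfl (g := fun _ => w z) fun k hk => hz k (by simpa using hk),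
    Finset.sum_const, smul_eq_zero, Finset.card_eq_zero] at h1
  rcases h1 with h1 | h1
  · exact Finset.notMem_empty (⟨n, hnK⟩ : Fin K) (h1 ▸ by simp)
  · exact hw z h1

theorem exists_pushWeight_ne_zero {K m : ℕ} (hm : 2 ≤ m) (hmK : m ≤ K) (w : Fin K → ℂ)
    (hw : ∀ k, w k ≠ 0) : ∃ c : Fin K → Fin m, ∀ i, pushWeight c w i ≠ 0 := by
  obtain ⟨n, rfl⟩ : ∃ n, m = n + 1 := ⟨m - 1, by omega⟩
  obtain ⟨σ, hσ⟩ := exists_perm_tail_sum_ne_zero (n := n) (by omega) (by omega) w hw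
  -- The first `n` fibres are singletons and the last one is the whole tail.
  let c : Fin K → Fin (n + 1) := fun k => ⟨min k n, by omega⟩
  refine ⟨c ∘ σ.symm, fun i => ?_⟩
  have hsum : pushWeight (c ∘ σ.symm) w i = ∑ k with c k = i, w (σ k) := by
    rw [pushWeight, Finset.sum_filter, Finset.sum_filter, ← Equiv.sum_comp σ]
    simp
  rw [hsum]
  rcases eq_or_ne (i : ℕ) n with hi | hi
  · convert hσ using 3
    simp only [c, Fin.ext_iff, hi]
    exact min_eq_right_iff
  · have hin : (i : ℕ) < n := by omega
    rw [Finset.sum_eq_single_of_mem (⟨i, by omega⟩ : Fin K)]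
    · exact hw _
    · simp only [c, Finset.mem_filter, Finset.mem_univ, true_and, Fin.ext_iff]
      omega
    · intro k hk hne
      simp only [c, Finset.mem_filter, Finset.mem_univ, true_and, Fin.ext_iff] at hk
      exact absurd (Fin.ext (by simp only; omega)) hne

/-- On only `m` points, `m` conditions force vanishing at every point, which determines a polynomial
of degree `m` up to its leading coefficient. -/
theorem orthPoly_eq_C_mul_nodal {m : ℕ} {w α : Fin m → ℂ} (hw : ∀ k, w k ≠ 0)
    (hα : Function.Injective α) :
    orthPoly w α m = C (hankel w α m).det * Lagrange.nodal Finset.univ α := by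
  have hdet := det_hankel_ne_zero hw hα
  have hdeg : (orthPoly w α m).degree = m := by
    rw [degree_eq_natDegree, natDegree_orthPoly hdet]
    intro h0
    exact hdet (by rw [← coeff_orthPoly, h0, coeff_zero])
  refine eq_of_degree_sub_lt_of_eval_index_eq (s := Finset.univ) (v := α) hα.injOn ?_ ?_
  · rw [Finset.card_univ, Fintype.card_fin, ← hdeg]
    refine degree_sub_lt_left ?_ (fun h0 => by simp [h0] at hdeg) ?_
    · rw [hdeg, degree_C_mul hdet, Lagrange.degree_nodal, Finset.card_univ, Fintype.card_fin]
    · rw [leadingCoeff_mul, leadingCoeff_C, Lagrange.nodal_monic.leadingCoeff, mul_one,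
        leadingCoeff, natDegree_orthPoly hdet, coeff_orthPoly]
  · intro i hi
    rw [eval_mul, Lagrange.eval_nodal_at_node hi, mul_zero]
    exact (orthogonal_orthPoly w α m).eval_eq_zero hw hα le_rfl i

/-! ### Separability and genericity -/

theorem separable_nodal {ι : Type*} (s : Finset ι) {β : ι → ℂ} (hβ : Set.InjOn β s) :
    (Lagrange.nodal s β).Separable := by
  exact separable_prod_X_sub_C_iff'.mpr hβ

theorem separable_C_mul {a : ℂ} (ha : a ≠ 0) {p : ℂ[X]} (hp : p.Separable) :
    (C a * p).Separable :=
  ((separable_C a).mpr ha.isUnit).mul hp ⟨C a⁻¹, 0, by rw [← C_mul, inv_mul_cancel₀ ha]; simp⟩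

/-- In characteristic zero the formal degrees `m` and `m - 1` are the true ones, so the resultant
detects a common root. -/
theorem resultant_derivative_eq_zero_iff {p : ℂ[X]} (hp : p ≠ 0) {m : ℕ} (hm : p.natDegree = m) :
    resultant p (derivative p) m (m - 1) = 0 ↔ ¬ p.Separable := by
  have h : (derivative p).natDegree = m - 1 := by rw [natDegree_derivative, hm]
  rw [← hm, hm, ← h, ← hm, resultant_eq_zero_iff, Polynomial.Separable]
  simp [hp]

/-- A polynomial in the data points, nonzero for nonzero weights, whose nonvanishing makes
the orthogonal polynomials as generic as needed. -/
theorem exists_genericity_polynomial {K : ℕ} (w : Fin K → ℂ) (hw : ∀ k, w k ≠ 0) :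
    ∃ g : MvPolynomial (Fin K) ℂ, g ≠ 0 ∧ ∀ α : Fin K → ℂ, MvPolynomial.eval α g ≠ 0 →
      (∀ m, 2 ≤ m → m ≤ K → (hankel w α m).det ≠ 0) ∧
      ∀ m, 2 ≤ m → m < K → (orthPoly w α m).Separable ∧
        ∀ k, (orthPoly w α m).eval (α k) ≠ 0 := by
  let u : Fin K → MvPolynomial (Fin K) ℂ := fun k => MvPolynomial.C (w k)
  let H (m : ℕ) := (hankel u MvPolynomial.X m).det
  let Q (m : ℕ) := orthPoly u MvPolynomial.X m
  -- The formal degrees are fixed so that the resultant commutes with evaluation at `α`, even where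
  -- the degree drops.
  let D (m : ℕ) := resultant (Q m) (derivative (Q m)) m (m - 1)
  let V (m : ℕ) := ∏ k, (Q m).eval (MvPolynomial.X k)
  have eH (α : Fin K → ℂ) (m : ℕ) : MvPolynomial.eval α (H m) = (hankel w α m).det := by
    simp [H, u, map_det_hankel]
  have eQ (α : Fin K → ℂ) (m : ℕ) :
      (Q m).map (MvPolynomial.eval α) = orthPoly w α m := by
    simp [Q, u, map_orthPoly]
  have eD (α : Fin K → ℂ) (m : ℕ) : MvPolynomial.eval α (D m) =
      resultant (orthPoly w α m) (derivative (orthPoly w α m)) m (m - 1) := by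
    rw [← eQ, derivative_map, resultant_map_map]
  have eV (α : Fin K → ℂ) (m : ℕ) :
      MvPolynomial.eval α (V m) = ∏ k, (orthPoly w α m).eval (α k) := by
    simp only [V, map_prod]
    refine Finset.prod_congr rfl fun k _ => ?_
    rw [← eQ, eval_map, eval, hom_eval₂, RingHom.comp_id, MvPolynomial.eval_X]
  have hcast (m : ℕ) : Function.Injective fun i : Fin m => ((i : ℕ) : ℂ) := fun i j h =>
    Fin.ext (Nat.cast_injective h)
  -- Test on `m` merged points, where the orthogonal polynomial is a nonzero multiple of the nodal
  -- polynomial.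
  have hH (m : ℕ) (h2 : 2 ≤ m) (hK : m ≤ K) : H m ≠ 0 ∧ D m ≠ 0 := by
    obtain ⟨c, hc⟩ := exists_pushWeight_ne_zero h2 hK w hw
    have hdet := det_hankel_ne_zero hc (hcast m)
    constructor <;> intro h0
    · have := eH ((fun i : Fin m => ((i : ℕ) : ℂ)) ∘ c) m
      rw [h0, map_zero, hankel_comp] at this
      exact hdet this.symm
    · have := eD ((fun i : Fin m => ((i : ℕ) : ℂ)) ∘ c) m
      rw [h0, map_zero, orthPoly_comp, eq_comm, resultant_derivative_eq_zero_iff _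
        (natDegree_orthPoly hdet), orthPoly_eq_C_mul_nodal hc (hcast m)] at this
      · refine this ?_
        exact separable_C_mul hdet (separable_nodal _ (hcast m).injOn)
      · intro h
        exact hdet (by rw [← coeff_orthPoly, h, coeff_zero])
  -- Here `m + 1` merged points are needed: on `m` points the orthogonal polynomial vanishes at all
  -- of them.
  have hV (m : ℕ) (h2 : 2 ≤ m) (hK : m < K) : V m ≠ 0 := by
    obtain ⟨c, hc⟩ := exists_pushWeight_ne_zero (m := m + 1) (by omega) hK w hw
    intro h0
    have := eV ((fun i : Fin (m + 1) => ((i : ℕ) : ℂ)) ∘ c) m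
    rw [h0, map_zero, orthPoly_comp, eq_comm, Finset.prod_eq_zero_iff] at this
    obtain ⟨k, -, hk⟩ := this
    exact orthPoly_eval_ne_zero hc (hcast _) (c k) hk
  refine ⟨(∏ m ∈ Finset.Icc 2 K, H m) * ∏ m ∈ Finset.Ico 2 K, D m * V m, ?_, fun α hα => ?_⟩
  · refine mul_ne_zero (Finset.prod_ne_zero_iff.mpr fun m hm => ?_)
      (Finset.prod_ne_zero_iff.mpr fun m hm => ?_)
    · exact (hH m (Finset.mem_Icc.mp hm).1 (Finset.mem_Icc.mp hm).2).1
    · have hm := Finset.mem_Ico.mp hm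
      exact mul_ne_zero (hH m hm.1 hm.2.le).2 (hV m hm.1 hm.2)
  · simp only [map_mul, map_prod, eH, eD, eV] at hα
    have h1 := Finset.prod_ne_zero_iff.mp (left_ne_zero_of_mul hα)
    have h2 := Finset.prod_ne_zero_iff.mp (right_ne_zero_of_mul hα)
    have hdet (m : ℕ) (hm : 2 ≤ m) (hmK : m ≤ K) := h1 m (Finset.mem_Icc.mpr ⟨hm, hmK⟩)
    refine ⟨hdet, fun m hm hmK => ⟨?_, fun k => ?_⟩⟩
    · have h := left_ne_zero_of_mul (h2 m (Finset.mem_Ico.mpr ⟨hm, hmK⟩))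
      have hd := hdet m hm hmK.le
      rwa [Ne, resultant_derivative_eq_zero_iff _ (natDegree_orthPoly hd), not_not] at h
      intro h
      exact hd (by rw [← coeff_orthPoly, h, coeff_zero])
    · have h := right_ne_zero_of_mul (h2 m (Finset.mem_Ico.mpr ⟨hm, hmK⟩))
      exact Finset.prod_ne_zero_iff.mp h k (Finset.mem_univ k)

/-! ### Construction with at least `K` roots -/

/-- Adding a suitable nonzero multiple of a lower-degree polynomial without common roots to a product of
distinct linear factors gives a separable polynomial. -/
theorem exists_separable_add_C_mul {ι : Type*} (s : Finset ι) {b : ι → ℂ} (hb : Set.InjOn b s)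
    (hs : s.Nonempty) {q : ℂ[X]} (hq : ∀ i ∈ s, q.eval (b i) ≠ 0) :
    ∃ c : ℂ, c ≠ 0 ∧ (Lagrange.nodal s b + C c * q).Separable := by
  classical
  set p := Lagrange.nodal s b with hp
  have hpsep : p.Separable := separable_nodal s hb
  -- A multiple root `z` of `p + c q` is a root of `W` with `c = -p z / q z`, so only finitely many
  -- `c` are bad once `W ≠ 0`; at a root of `p`, `W` equals `p' q ≠ 0`.
  let W := derivative p * q - p * derivative q
  have hW : W ≠ 0 := by
    obtain ⟨i, hi⟩ := hs
    intro h0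
    have h := congrArg (eval (b i)) h0
    simp only [W, eval_sub, eval_mul, eval_zero, hp, Lagrange.eval_nodal_at_node hi, zero_mul,
      sub_zero, mul_eq_zero, hq i hi, or_false] at h
    obtain ⟨u, v, huv⟩ := hpsep
    have := congrArg (eval (b i)) huv
    simp [hp, Lagrange.eval_nodal_at_node hi, h] at this
  obtain ⟨c, hc⟩ := Infinite.exists_notMem_finset
    (insert 0 (W.roots.toFinset.image fun z => -p.eval z / q.eval z))
  rw [Finset.mem_insert, not_or] at hc
  refine ⟨c, hc.1, ?_⟩
  rw [Polynomial.Separable, isCoprime_iff_aeval_ne_zero_of_isAlgClosed ℂ ℂ]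
  intro z
  by_contra! h
  simp only [coe_aeval_eq_eval, eval_add, eval_mul, eval_C, derivative_add, derivative_C_mul]
    at h
  obtain ⟨h1, h2⟩ := h
  have hqz : q.eval z ≠ 0 := by
    intro h0
    rw [h0, mul_zero, add_zero, hp, Lagrange.eval_nodal, Finset.prod_eq_zero_iff] at h1
    obtain ⟨i, hi, hz⟩ := h1
    exact hq i hi (by rwa [← sub_eq_zero.mp hz])
  refine hc.2 (Finset.mem_image.mpr ⟨z, ?_, ?_⟩)
  · rw [Multiset.mem_toFinset, mem_roots hW, IsRoot.def]
    simp only [W, eval_sub, eval_mul]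
    linear_combination q.eval z * h2 - (derivative q).eval z * h1
  · rw [div_eq_iff hqz]
    linear_combination -h1

/-- The sum is the coefficient of `X ^ (K - 1)` in the interpolant of `X ^ j`, which is `X ^ j`
itself. -/
theorem sum_nodalWeight_mul_pow {K : ℕ} {α : Fin K → ℂ} (hα : Function.Injective α) {j : ℕ}
    (hj : j < K - 1) : ∑ k, Lagrange.nodalWeight Finset.univ α k * α k ^ j = 0 := by
  have h := Lagrange.coeff_eq_sum (s := Finset.univ) (v := α) hα.injOn (P := X ^ j) (by
    rw [degree_X_pow, Finset.card_univ, Fintype.card_fin]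
    exact_mod_cast (by omega : j < K))
  rw [Finset.card_univ, Fintype.card_fin, coeff_X_pow, if_neg hj.ne'] at h
  rw [h]
  refine Finset.sum_congr rfl fun k _ => ?_
  rw [Lagrange.nodalWeight, eval_pow, eval_X, Finset.prod_inv_distrib, div_eq_mul_inv, mul_comm]

/-- Take `p = nodal t + c q`, where `q` interpolates `nodalWeight / wₖ` and `t` contains all data
points. Then `p (αₖ) = c * nodalWeight / wₖ`, the weights cancel, and `sum_nodalWeight_mul_pow`
applies. -/
theorem exists_separable_orthogonal_of_le {K m : ℕ} (hK : 0 < K) (hKm : K ≤ m) {w α : Fin K → ℂ}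
    (hw : ∀ k, w k ≠ 0) (hα : Function.Injective α) :
    ∃ p : ℂ[X], p.Monic ∧ p.natDegree = m ∧ p.Separable ∧ (∀ k, p.eval (α k) ≠ 0) ∧
      Orthogonal w α p (K - 1) := by
  classical
  let q := Lagrange.interpolate Finset.univ α fun k =>
    Lagrange.nodalWeight Finset.univ α k / w k
  have hqα (k) : q.eval (α k) = Lagrange.nodalWeight Finset.univ α k / w k :=
    Lagrange.eval_interpolate_at_node _ hα.injOn (Finset.mem_univ k)
  have hqα0 (k) : q.eval (α k) ≠ 0 := by
    rw [hqα]
    exact div_ne_zero (Lagrange.nodalWeight_ne_zero hα.injOn (Finset.mem_univ k)) (hw k)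
  have hq0 : q ≠ 0 := fun h => hqα0 ⟨0, hK⟩ (by rw [h, eval_zero])
  have hqdeg : q.degree < K := by
    have := Lagrange.degree_interpolate_lt (s := Finset.univ) (v := α)
      (fun k => Lagrange.nodalWeight Finset.univ α k / w k) hα.injOn
    rwa [Finset.card_univ, Fintype.card_fin] at this
  -- The `m - K` further points of `t` avoid the roots of `q`, so that `nodal t` and `q` share no
  -- root.
  obtain ⟨t, ht, htc⟩ : ∃ t : Finset ℂ, Finset.univ.image α ⊆ t ∧ t.card = m ∧
      ∀ z ∈ t, q.eval z ≠ 0 := by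
    obtain ⟨e, he, hem⟩ := Set.Infinite.exists_subset_card_eq
      (s := ((q.roots.toFinset ∪ Finset.univ.image α : Finset ℂ) : Set ℂ)ᶜ)
      (Set.Finite.infinite_compl (Finset.finite_toSet _)) (m - K)
    have hout (z) (hz : z ∈ e) : z ∉ q.roots.toFinset ∪ Finset.univ.image α := by
      simpa using he hz
    refine ⟨Finset.univ.image α ∪ e, Finset.subset_union_left, ?_, fun z hz => ?_⟩
    · rw [Finset.card_union_of_disjoint, Finset.card_image_of_injective _ hα, hem,
        Finset.card_univ, Fintype.card_fin]
      · omega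
      · rw [Finset.disjoint_right]
        exact fun z hz h => hout z hz (Finset.mem_union_right _ h)
    · rcases Finset.mem_union.mp hz with h | h
      · obtain ⟨k, -, rfl⟩ := Finset.mem_image.mp h
        exact hqα0 k
      · intro h0
        exact hout z h (Finset.mem_union_left _ (by simp [hq0, h0]))
  obtain ⟨htm, htq⟩ := htc
  obtain ⟨c, hc, hsep⟩ := exists_separable_add_C_mul t (b := id) Function.injective_id.injOn
    (Finset.card_pos.mp (by omega)) htq
  have hlt : (C c * q).degree < (Lagrange.nodal t id : ℂ[X]).degree := by
    rw [degree_C_mul hc, Lagrange.degree_nodal, htm]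
    exact hqdeg.trans_le (by exact_mod_cast hKm)
  have heval (k) : (Lagrange.nodal t id + C c * q).eval (α k) =
      c * (Lagrange.nodalWeight Finset.univ α k / w k) := by
    have : (Lagrange.nodal t id).eval (α k) = 0 := Lagrange.eval_nodal_at_node (v := id)
      (ht (Finset.mem_image_of_mem α (Finset.mem_univ k)))
    rw [eval_add, this, zero_add, eval_mul, eval_C, hqα]
  refine ⟨_, Lagrange.nodal_monic.add_of_left hlt, ?_, hsep, fun k => ?_, fun j hj => ?_⟩
  · rw [natDegree_add_eq_left_of_degree_lt hlt, Lagrange.natDegree_nodal, htm]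
  · rw [heval, ← hqα]
    exact mul_ne_zero hc (hqα0 k)
  · rw [← mul_zero c, ← sum_nodalWeight_mul_pow hα hj, Finset.mul_sum]
    refine Finset.sum_congr rfl fun k _ => ?_
    rw [heval]
    field_simp [hw k]

/-! ### Evaluation points and decoding -/

theorem exists_nodal_eq {ι : Type*} [Fintype ι] {p : ℂ[X]} (hp : p.Monic) (hsep : p.Separable)
    (hcard : p.natDegree = Fintype.card ι) :
    ∃ β : ι → ℂ, Function.Injective β ∧ Lagrange.nodal Finset.univ β = p := by
  classical
  have hnodup := nodup_roots hsep
  have hrc : p.roots.card = p.natDegree := IsAlgClosed.card_roots_eq_natDegree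
  obtain ⟨e⟩ : Nonempty (ι ≃ p.roots.toFinset) := Fintype.card_eq.mp (by
    rw [Fintype.card_coe, Multiset.toFinset_card_of_nodup hnodup, hrc, hcard])
  refine ⟨fun i => e i, Subtype.val_injective.comp e.injective, ?_⟩
  rw [Lagrange.nodal, Equiv.prod_comp e fun z : p.roots.toFinset => X - C (z : ℂ),
    Finset.prod_coe_sort p.roots.toFinset fun z => X - C z]
  conv_rhs => rw [(IsAlgClosed.splits p).eq_prod_roots_of_monic hp]
  rw [Finset.prod, Multiset.toFinset_val, hnodup.dedup]

theorem admissible_of_nodal_eval_ne_zero {K : ℕ} {ι : Type*} [Fintype ι] {α : Fin K → ℂ}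
    {β : ι → ℂ} (hβ : Function.Injective β)
    (h : ∀ k, (Lagrange.nodal Finset.univ β).eval (α k) ≠ 0) : Admissible α β := by
  refine ⟨hβ, Set.disjoint_left.mpr ?_⟩
  rintro _ ⟨k, rfl⟩ ⟨i, hi⟩
  exact h k (by rw [← hi]; exact Lagrange.eval_nodal_at_node (Finset.mem_univ i))

theorem Admissible.nodal_eval_ne_zero {K : ℕ} {ι : Type*} {s : Finset ι} {α : Fin K → ℂ}
    {β : ι → ℂ} (h : Admissible α β) (k : Fin K) : (Lagrange.nodal s β).eval (α k) ≠ 0 := by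
  refine Lagrange.eval_nodal_not_at_node fun i _ hi => ?_
  exact Set.disjoint_left.mp h.2 ⟨k, rfl⟩ ⟨i, hi.symm⟩

theorem Admissible.exists_extension {K N : ℕ} {s : Finset (Fin N)} {α : Fin K → ℂ}
    {β : {n // n ∈ s} → ℂ} (h : Admissible α β) :
    ∃ γ : Fin N → ℂ, Admissible α γ ∧ ∀ n : {n // n ∈ s}, γ n = β n := by
  classical
  let e := Set.Infinite.natEmbedding (Set.range α ∪ Set.range β)ᶜ
    (Set.Finite.infinite_compl ((Set.finite_range α).union (Set.finite_range β)))
  have he (n : ℕ) : (e n : ℂ) ∉ Set.range α ∧ (e n : ℂ) ∉ Set.range β := by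
    simpa only [Set.mem_compl_iff, Set.mem_union, not_or] using (e n).2
  refine ⟨fun n => if hn : n ∈ s then β ⟨n, hn⟩ else e n, ⟨fun m n hmn => ?_, ?_⟩,
    fun n => dif_pos n.2⟩
  · simp only at hmn
    split_ifs at hmn with hm hn hn
    · simpa using h.1 hmn
    · exact absurd ⟨_, hmn⟩ (he n).2
    · exact absurd ⟨_, hmn.symm⟩ (he m).2
    · exact Fin.ext (e.injective (Subtype.ext hmn))
  · rw [Set.disjoint_right]
    rintro _ ⟨n, rfl⟩
    simp only
    split_ifs with hn
    · exact Set.disjoint_right.mp h.2 ⟨_, rfl⟩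
    · exact (he n).1

theorem nodal_eq_nodal_mul_nodal_sdiff {N : ℕ} {s A : Finset (Fin N)} (hs : s ⊆ A)
    {γ : Fin N → ℂ} {β : {n // n ∈ s} → ℂ} (h : ∀ n : {n // n ∈ s}, γ n = β n) :
    Lagrange.nodal A γ = Lagrange.nodal Finset.univ β * Lagrange.nodal (A \ s) γ := by
  simp only [Lagrange.nodal]
  rw [← Finset.prod_sdiff hs, mul_comm, ← Finset.prod_coe_sort s]
  simp only [h]

/-- The orthogonality conditions on the nodal polynomials make the scheme feasible. -/
theorem feasible_of_orthogonal {K d S N : ℕ} (hN : S < N)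
    (hN' : N ≤ d * (K - 1) + S) {w α : Fin K → ℂ} (hα : Function.Injective α) {β : Fin N → ℂ}
    (hβ : Function.Injective β) {P : NonStragglerPattern N S}
    (h : ∀ A ∈ P.sets, Orthogonal w α (Lagrange.nodal A β) (numConditions K d S N)) :
    Feasible d w α β P := by
  intro q v F X hF A hA
  ext a b
  simp only [decodedOutput, aggregation, Matrix.sum_apply, Matrix.smul_apply, Matrix.map_apply,
    smul_eq_mul, decoder, Matrix.of_apply, response]
  set E : ℂ[X] := encoder α X a b with hE
  have hEα (k) : E.eval (α k) = X k a b :=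
    Lagrange.eval_interpolate_at_node _ hα.injOn (Finset.mem_univ k)
  have hEdeg : E.natDegree ≤ K - 1 := by
    have := Lagrange.degree_interpolate_le (s := Finset.univ) (v := α) (fun k => X k a b) hα.injOn
    rw [Finset.card_univ, Fintype.card_fin] at this
    exact natDegree_le_iff_degree_le.mpr this
  set G := F.comp E with hG
  have hGdeg : G.natDegree ≤ d * (K - 1) := by
    rw [hG, natDegree_comp, hF]
    exact Nat.mul_le_mul_left d hEdeg
  have hmon : (Lagrange.nodal A β).Monic := Lagrange.nodal_monic
  -- The decoder is the remainder of `F ∘ E` modulo the nodal polynomial, so the error is that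
  -- polynomial times the quotient, whose degree is below `C`.
  have hD : Lagrange.interpolate A β (fun n => F.eval (E.eval (β n))) =
      G %ₘ Lagrange.nodal A β := by
    symm
    refine Lagrange.eq_interpolate_of_eval_eq _ hβ.injOn ?_ fun n hn => ?_
    · have := degree_modByMonic_lt G hmon
      rwa [Lagrange.degree_nodal] at this
    · have := congrArg (eval (β n)) (modByMonic_add_div G (Lagrange.nodal A β))
      rw [eval_add, eval_mul, Lagrange.eval_nodal_at_node hn, zero_mul, add_zero] at this
      rw [this, hG, eval_comp]
  have hquot : (G /ₘ Lagrange.nodal A β).degree < numConditions K d S N := by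
    refine degree_le_natDegree.trans_lt ?_
    rw [natDegree_divByMonic _ hmon, Lagrange.natDegree_nodal, P.card_eq A hA]
    have : G.natDegree - (N - S) < numConditions K d S N := by
      rw [numConditions]
      omega
    exact_mod_cast this
  have hzero := (h A hA).sum_eval_mul hquot
  rw [hD, ← sub_eq_zero, ← Finset.sum_sub_distrib, ← neg_eq_zero, ← Finset.sum_neg_distrib,
    ← hzero]
  refine Finset.sum_congr rfl fun k _ => ?_
  have := congrArg (eval (α k)) (modByMonic_add_div G (Lagrange.nodal A β))
  rw [eval_add, hG, eval_comp, hEα, ← hG] at this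
  rw [← this]
  ring

theorem inter_subset {N S : ℕ} (P : NonStragglerPattern N S) {A : Finset (Fin N)}
    (hA : A ∈ P.sets) : P.inter ⊆ A := fun _ hn => (Finset.mem_filter.mp hn).2 A hA

theorem interCard_le {N S : ℕ} (P : NonStragglerPattern N S) : P.interCard ≤ N - S := by
  obtain ⟨A, hA⟩ := P.nonempty
  rw [← P.card_eq A hA]
  exact Finset.card_le_card (inter_subset P hA)

/-! ### The threshold -/

/-- Below the threshold no nonvanishing polynomial satisfies the conditions. -/
theorem threshold_le_of_orthogonal {K d m : ℕ} (hK : 0 < K) (hd : 0 < d) {w α : Fin K → ℂ}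
    (hw : ∀ k, w k ≠ 0) (hα : Function.Injective α)
    (hdet : ∀ n, 2 ≤ n → n ≤ K → (hankel w α n).det ≠ 0) {p : ℂ[X]} (hp : p.natDegree = m)
    (hpα : ∀ k, p.eval (α k) ≠ 0) (h : Orthogonal w α p (d * (K - 1) + 1 - m)) :
    threshold K d ≤ m := by
  by_contra! hlt
  have hbig : ¬ K ≤ d * (K - 1) + 1 - m := fun hle => hpα ⟨0, hK⟩ (h.eval_eq_zero hw hα hle _)
  have hd1 : d = 1 := by
    by_contra hd1
    rw [threshold, if_neg hd1] at hlt
    obtain ⟨e, rfl⟩ : ∃ e, d = e + 1 := ⟨d - 1, by omega⟩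
    rw [Nat.add_sub_cancel] at hlt
    rw [Nat.succ_mul] at hbig
    omega
  subst hd1
  rw [threshold, if_pos rfl] at hlt
  -- Here `d = 1` and `m ≤ (K - 1) / 2`, so there are `K - m ≥ m + 1` conditions. The Hankel size is
  -- at least `2` because `hbig` excludes `m = 0`.
  refine hdet (m + 1) (by omega) (by omega) ((det_hankel_eq_zero_iff w α (m + 1)).mpr
    ⟨p, fun h0 => hpα ⟨0, hK⟩ (by rw [h0, eval_zero]), ?_, h.mono (by omega)⟩)
  refine degree_le_natDegree.trans_lt ?_
  rw [hp]
  exact_mod_cast Nat.lt_succ_self m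

/-- For `d = 1` the normalised orthogonal polynomial works, since `K - m ≤ m`; the bound `3 ≤ d * (K
- 1) + 1` then gives `m ≥ 2`, where genericity is available. For `d ≥ 2` it gives `K ≥ 2`, hence `m
≥ K` and at most `K - 1` conditions. -/
theorem exists_separable_orthogonal {K d m : ℕ} (hK : 3 ≤ d * (K - 1) + 1) (hm : m ≤ d * (K - 1))
    {w α : Fin K → ℂ} (hw : ∀ k, w k ≠ 0) (hα : Function.Injective α)
    (hdet : ∀ n, 2 ≤ n → n ≤ K → (hankel w α n).det ≠ 0)
    (horth : ∀ n, 2 ≤ n → n < K → (orthPoly w α n).Separable ∧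
      ∀ k, (orthPoly w α n).eval (α k) ≠ 0) (hthr : threshold K d ≤ m) :
    ∃ p : ℂ[X], p.Monic ∧ p.natDegree = m ∧ p.Separable ∧ (∀ k, p.eval (α k) ≠ 0) ∧
      Orthogonal w α p (d * (K - 1) + 1 - m) := by
  rw [threshold] at hthr
  split_ifs at hthr with hd1
  · subst hd1
    rw [one_mul] at *
    have hd := hdet m (by omega) (by omega)
    obtain ⟨hsep, hα'⟩ := horth m (by omega) (by omega)
    have hi := inv_ne_zero hd
    refine ⟨C (hankel w α m).det⁻¹ * orthPoly w α m, ?_, ?_, separable_C_mul hi hsep,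
      fun k => ?_, ?_⟩
    · rw [Monic, leadingCoeff_mul, leadingCoeff_C, leadingCoeff, natDegree_orthPoly hd,
        coeff_orthPoly, inv_mul_cancel₀ hd]
    · rw [natDegree_C_mul hi, natDegree_orthPoly hd]
    · rw [eval_mul, eval_C]
      exact mul_ne_zero hi (hα' k)
    · rw [mul_comm]
      exact (orthogonal_orthPoly w α m).mul_right (by rw [natDegree_C]; omega)
  · have hK0 : 0 < K - 1 := by
      rcases Nat.eq_zero_or_pos (K - 1) with h | h
      · rw [h] at hK
        omega
      · exact h
    obtain ⟨e, rfl⟩ : ∃ e, d = e + 2 := by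
      refine ⟨d - 2, ?_⟩
      rcases Nat.eq_zero_or_pos d with rfl | h
      · omega
      · omega
    have hmul : (e + 2 - 1) * (K - 1) = e * (K - 1) + (K - 1) := Nat.succ_mul e (K - 1)
    have hmul' : (e + 2) * (K - 1) = e * (K - 1) + (K - 1) + (K - 1) := by ring
    obtain ⟨p, h1, h2, h3, h4, h5⟩ :=
      exists_separable_orthogonal_of_le (m := m) (by omega) (by omega) hw hα
    exact ⟨p, h1, h2, h3, h4, h5.mono (by omega)⟩

end CPA

theorem theorem2 (K d S N : ℕ) (hK : 0 < K) (hd : 0 < d) (hS : 0 < S)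
    (hN : S + 2 ≤ N) (hN' : N ≤ d * (K - 1) + S)
    (w : Fin K → ℂ) (hw : ∀ k, w k ≠ 0) :
    ∃ J : Ideal (MvPolynomial (Fin K) ℂ),
      MvPolynomial.zeroLocus ℂ J ≠ Set.univ ∧
      ∀ α : Fin K → ℂ, α ∉ MvPolynomial.zeroLocus ℂ J → Function.Injective α →
        ∀ P : NonStragglerPattern N S,
          ((∃ β : {n // n ∈ P.inter} → ℂ,
              CPA.Admissible α β ∧
              CPA.Orthogonal w α (Lagrange.nodal Finset.univ β)
                (CPA.numConditions K d S N + P.excess)) ↔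
            CPA.threshold K d ≤ P.interCard) ∧
          (CPA.threshold K d ≤ P.interCard →
            ∃ β : Fin N → ℂ,
              CPA.Admissible α β ∧
              (∀ A ∈ P.sets, CPA.Orthogonal w α (Lagrange.nodal A β)
                (CPA.numConditions K d S N)) ∧
              CPA.Feasible d w α β P) := by
  obtain ⟨g, hg0, hg⟩ := CPA.exists_genericity_polynomial w hw
  have hmem (α : Fin K → ℂ) :
      α ∈ MvPolynomial.zeroLocus ℂ (Ideal.span {g}) ↔ MvPolynomial.eval α g = 0 := by
    rw [MvPolynomial.zeroLocus_span]
    simp [MvPolynomial.aeval_eq_eval]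
  refine ⟨Ideal.span {g}, fun huniv => hg0 (MvPolynomial.funext fun α => ?_), ?_⟩
  · rw [map_zero, ← hmem, huniv]
    trivial
  intro α hαg hα P
  obtain ⟨hdet, horth⟩ := hg α (by rwa [hmem] at hαg)
  have hI := CPA.interCard_le P
  have hcard : Fintype.card {n // n ∈ P.inter} = P.interCard := Fintype.card_coe _
  -- The count depends on the pattern only through `I`: both `N` and `S` cancel.
  have hcount : CPA.numConditions K d S N + P.excess = d * (K - 1) + 1 - P.interCard := by
    rw [CPA.numConditions, NonStragglerPattern.excess]
    omega
  have hexists (hthr : CPA.threshold K d ≤ P.interCard) : ∃ β : {n // n ∈ P.inter} → ℂ,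
      CPA.Admissible α β ∧ CPA.Orthogonal w α (Lagrange.nodal Finset.univ β)
        (CPA.numConditions K d S N + P.excess) := by
    obtain ⟨p, hmon, hdeg, hsep, hpα, hp⟩ := CPA.exists_separable_orthogonal
      (m := P.interCard) (by omega) (by omega) hw hα hdet horth hthr
    obtain ⟨β, hβ, rfl⟩ := CPA.exists_nodal_eq hmon hsep (hdeg.trans hcard.symm)
    exact ⟨β, CPA.admissible_of_nodal_eval_ne_zero hβ hpα, by rwa [hcount]⟩
  refine ⟨⟨?_, hexists⟩, fun hthr => ?_⟩
  · rintro ⟨β, hβ, h⟩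
    rw [hcount] at h
    exact CPA.threshold_le_of_orthogonal hK hd hw hα hdet
      (by rw [Lagrange.natDegree_nodal, Finset.card_univ, hcard]) hβ.nodal_eval_ne_zero h
  · obtain ⟨β, hβ, h⟩ := hexists hthr
    obtain ⟨γ, hγ, hγβ⟩ := hβ.exists_extension
    have horthA : ∀ A ∈ P.sets, CPA.Orthogonal w α (Lagrange.nodal A γ)
        (CPA.numConditions K d S N) := by
      intro A hA
      rw [CPA.nodal_eq_nodal_mul_nodal_sdiff (CPA.inter_subset P hA) hγβ]
      -- The cofactor has degree `|A \ 𝓘| = L`, exactly the surplus of conditions.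
      refine h.mul_right ?_
      rw [Lagrange.natDegree_nodal, Finset.card_sdiff_of_subset (CPA.inter_subset P hA),
        P.card_eq A hA, NonStragglerPattern.excess, NonStragglerPattern.interCard, add_comm]
    exact ⟨γ, hγ, horthA, CPA.feasible_of_orthogonal (by omega) hN' hα hγ.1 horthA⟩
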